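/- Let $d\ge 1$, let $\Omega\subset\mathbb{R}^d$ be a bounded open set, and let $\theta\in\mathbb{R}^d$ with $|\theta|=1$. Let $W_\theta(\Omega)$ be the set of $u\in L^2(\Omega)$ for which there is $v\in L^2(\Omega)$ with $\int_\Omega u\,(\theta\cdot\nabla\varphi)\,dx=-\int_\Omega v\varphi\,dx$ for all $\varphi\in C_c^\infty(\Omega)$. Let $H_\theta=\{y\in\mathbb{R}^d: y\cdot\theta=0\}$, with its $(d-1)$-dimensional Lebesgue measure $\lambda^{d-1}$, let $\mathcal{P}_\theta$ be the orthogonal projection onto $H_\theta$, and for $y\in H_\theta$ let $\omega_\theta(y)=\{s\in\mathbb{R}: s\theta+y\in\Omega\}$, an open set, and let $\mathcal{I}_\theta(y)$ be the set of disjoint nonempty open intervals whose union is $\omega_\theta(y)$. A function $g:\partial\Omega\to\mathbb{R}$ is called a directional trace of $u\in W_\theta(\Omega)$ in the direction $\theta$ if there are a representative of $u$, again denoted by $u$, and a set $A\subset\mathcal{P}_\theta(\Omega)$ such that $\mathcal{P}_\theta(\Omega)\setminus A$ is $\lambda^{d-1}$-negligible and, for every $y\in A$, the function $s\mapsto u(s\theta+y)$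 belongs to $H^1(\omega_\theta(y))$ and, for every $]\alpha,\beta[\,\in\mathcal{I}_\theta(y)$, there is a continuous function $f:\,]\alpha,\beta]\to\mathbb{R}$ with $f(s)=u(s\theta+y)$ for a.e. $s\in\,]\alpha,\beta[$ and $g(\beta\theta+y)=f(\beta)$. The set of all directional traces of $u$ in the direction $\theta$ is denoted by $\gamma_\theta u$. For $x\in\Omega$ let $\delta_\theta(x)=\sup\{s\ge0: x+t\theta\in\Omega\text{ for all }t\in[0,s[\}$ and $\Phi_\theta(x)=x+\delta_\theta(x)\theta\in\partial\Omega$, and let $\mu_\theta$ be the Borel measure on $\partial\Omega$ given by $\mu_\theta(B)=\int_\Omega\chi_B(\Phi_\theta(x))\,dx$ for all Borel sets $B\subset\partial\Omega$. **Theorem.** Let $u\in W_\theta(\Omega)$. 1. If $g$ is a directional trace of $u$ in the direction $\theta$, then a function $\widetilde g:\partial\Omega\to\mathbb{R}$ is a directional trace of $u$ in the direction $\theta$ if and only if $\widetilde g(z)=g(z)$ for $\mu_\theta$-a.e. $z\in\partial\Omega$. 2. Consequently $\gamma_\theta u$ is the equivalence class, for the relation of $\mu_\theta$-a.e. equality on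 functions $\partial\Omega\to\mathbb{R}$, of a Borel measurable function: there is a Borel measurable $g_0:\partial\Omega\to\mathbb{R}$ such that $\gamma_\theta u=\{g:\partial\Omega\to\mathbb{R} \;:\; g=g_0\ \ \mu_\theta\text{-a.e.}\}$. In particular $\gamma_\theta u$ is not empty. -/

import Mathlib

open MeasureTheory Set
open scoped ENNReal

noncomputable section

namespace DirTrace

/-- The Euclidean space `ℝ^d`. -/
abbrev E (d : ℕ) : Type := EuclideanSpace ℝ (Fin d)

variable {d : ℕ}

/-- `φ ∈ C_c^∞(Ω)`, for a function `φ` extended by `0` outside `Ω`. -/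
def IsTestFunction {V : Type*} [NormedAddCommGroup V] [NormedSpace ℝ V]
    (Ω : Set V) (φ : V → ℝ) : Prop :=
  ContDiff ℝ ((⊤ : ℕ∞) : WithTop ℕ∞) φ ∧ HasCompactSupport φ ∧ tsupport φ ⊆ Ω

/-- `v` is the weak derivative of `u` on `Ω` in the direction `θ`. Here `lineDeriv ℝ φ x θ` is the
derivative at `h = 0` of `h ↦ φ (x + h θ)`. -/
def HasWeakDirDeriv (Ω : Set (E d)) (θ : E d) (u v : Lp ℝ 2 (volume.restrict Ω)) : Prop :=
  ∀ φ : E d → ℝ, IsTestFunction Ω φ →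
    ∫ x in Ω, u x * lineDeriv ℝ φ x θ = - ∫ x in Ω, v x * φ x

/-- The space `W_θ(Ω)` of all `u ∈ L²(Ω)` whose weak derivative in the direction `θ` exists and
belongs to `L²(Ω)`. -/
def W (Ω : Set (E d)) (θ : E d) : Set (Lp ℝ 2 (volume.restrict Ω)) :=
  {u | ∃ v : Lp ℝ 2 (volume.restrict Ω), HasWeakDirDeriv Ω θ u v}

/-- The function `f` (more precisely, its class for a.e. equality on `ω`) belongs to the Sobolev
space `H¹(ω)`, `ω` an open subset of `ℝ`. -/
def MemH1 (ω : Set ℝ) (f : ℝ → ℝ) : Prop :=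
  MemLp f 2 (volume.restrict ω) ∧
    ∃ f' : ℝ → ℝ, MemLp f' 2 (volume.restrict ω) ∧
      ∀ φ : ℝ → ℝ, IsTestFunction ω φ →
        ∫ s in ω, f s * deriv φ s = - ∫ s in ω, f' s * φ s

/-- The hyperplane `H_θ` orthogonal to `θ`. -/
abbrev H (θ : E d) : Submodule ℝ (E d) := (ℝ ∙ θ)ᗮ

/-- The Lebesgue measure `λ^{d-1}` of the Euclidean space `H_θ`. The instance is spelled out to
exclude the restriction of the measure of `ℝ^d` to the subtype. -/
def hyperplaneMeasure (θ : E d) : Measure (H θ) :=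
  (measureSpaceOfInnerProductSpace (E := H θ)).volume

/-- The image `P_θ(Ω)` of `Ω` under the orthogonal projection onto `H_θ`. -/
def shadow (Ω : Set (E d)) (θ : E d) : Set (H θ) :=
  (H θ).orthogonalProjectionOnto '' Ω

/-- `ω_θ(y) = {s ∈ ℝ : s θ + y ∈ Ω}`. -/
def slice (Ω : Set (E d)) (θ : E d) (y : H θ) : Set ℝ :=
  {s : ℝ | s • θ + (y : E d) ∈ Ω}

/-- The pairs `(α, β)` such that `]α, β[` is one of the disjoint nonempty bounded open intervals
whose union is `ω`, `ω` a bounded open subset of `ℝ`; see `iUnion_intervals` and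
`pairwiseDisjoint_intervals`. -/
def intervals (ω : Set ℝ) : Set (ℝ × ℝ) :=
  {p | p.1 < p.2 ∧ Ioo p.1 p.2 ⊆ ω ∧ p.1 ∉ ω ∧ p.2 ∉ ω}

theorem iUnion_intervals {ω : Set ℝ} (ho : IsOpen ω) (hb : Bornology.IsBounded ω) :
    ⋃ p ∈ intervals ω, Ioo p.1 p.2 = ω := by
  apply Subset.antisymm
  · exact iUnion₂_subset fun p hp => hp.2.1
  intro s hs
  obtain ⟨R, hR⟩ := hb.subset_ball 0
  have hR' : ∀ t, R ≤ |t| → t ∉ ω := fun t ht h => by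
    have := hR h
    rw [Metric.mem_ball, dist_zero_right, Real.norm_eq_abs] at this
    linarith
  have c1 : IsClosed (ωᶜ ∩ Ici s) := ho.isClosed_compl.inter isClosed_Ici
  have c2 : IsClosed (ωᶜ ∩ Iic s) := ho.isClosed_compl.inter isClosed_Iic
  have n1 : (ωᶜ ∩ Ici s).Nonempty :=
    ⟨max R s, hR' _ ((le_max_left R s).trans (le_abs_self _)), mem_Ici.2 (le_max_right R s)⟩
  have n2 : (ωᶜ ∩ Iic s).Nonempty :=
    ⟨min (-R) s, hR' _ (by have := min_le_left (-R) s; have := neg_abs_le (min (-R) s); linarith),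
      mem_Iic.2 (min_le_right _ _)⟩
  have b1 : BddBelow (ωᶜ ∩ Ici s) := ⟨s, fun t ht => ht.2⟩
  have b2 : BddAbove (ωᶜ ∩ Iic s) := ⟨s, fun t ht => ht.2⟩
  have m1 := c1.csInf_mem n1 b1
  have m2 := c2.csSup_mem n2 b2
  set β := sInf (ωᶜ ∩ Ici s)
  set α := sSup (ωᶜ ∩ Iic s)
  have h1 : s < β := lt_of_le_of_ne m1.2 fun h => m1.1 (h ▸ hs)
  have h2 : α < s := lt_of_le_of_ne m2.2 fun h => m2.1 (h ▸ hs)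
  refine mem_iUnion₂.2 ⟨(α, β), ⟨h2.trans h1, fun t ht => ?_, m2.1, m1.1⟩, h2, h1⟩
  by_contra h
  rcases le_total s t with hst | hst
  · exact absurd ht.2 (not_lt.2 (csInf_le b1 ⟨h, hst⟩))
  · exact absurd ht.1 (not_lt.2 (le_csSup b2 ⟨h, hst⟩))

theorem pairwiseDisjoint_intervals (ω : Set ℝ) :
    (intervals ω).PairwiseDisjoint fun p => Ioo p.1 p.2 := by
  rintro ⟨a, b⟩ ⟨-, hab, ha, hb⟩ ⟨a', b'⟩ ⟨-, hab', ha', hb'⟩ hne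
  refine disjoint_left.2 fun t ht ht' => hne ?_
  simp only [mem_Ioo] at ht ht' ha hb ha' hb'
  have e1 : a = a' := by
    rcases lt_trichotomy a a' with h | h | h
    · exact absurd (hab ⟨h, by linarith⟩) ha'
    · exact h
    · exact absurd (hab' ⟨h, by linarith⟩) ha
  have e2 : b = b' := by
    rcases lt_trichotomy b b' with h | h | h
    · exact absurd (hab' ⟨by linarith, h⟩) hb
    · exact h
    · exact absurd (hab ⟨by linarith, h⟩) hb'
  rw [e1, e2]

/-- `g : ∂Ω → ℝ` is a directional trace of `u` in the direction `θ`: for some representative `w` of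
`u` and some `A ⊆ P_θ(Ω)` with `λ^{d-1}`-negligible complement in `P_θ(Ω)`, the function
`s ↦ w (s θ + y)` belongs to `H¹(ω_θ(y))` for each `y ∈ A` and, for each interval `]α, β[` of
`ω_θ(y)`, it has a continuous representative `f` on `]α, β]` whose value at `β` is `g (β θ + y)`. -/
def IsDirectionalTrace (Ω : Set (E d)) (θ : E d) (u : Lp ℝ 2 (volume.restrict Ω))
    (g : frontier Ω → ℝ) : Prop :=
  ∃ w : E d → ℝ, w =ᵐ[volume.restrict Ω] u ∧
    ∃ A : Set (H θ), A ⊆ shadow Ω θ ∧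
      hyperplaneMeasure θ (shadow Ω θ \ A) = 0 ∧
      ∀ y ∈ A,
        MemH1 (slice Ω θ y) (fun s => w (s • θ + (y : E d))) ∧
        ∀ α β : ℝ, (α, β) ∈ intervals (slice Ω θ y) →
          ∃ f : ℝ → ℝ, ContinuousOn f (Ioc α β) ∧
            (∀ᵐ s ∂(volume.restrict (Ioo α β)), f s = w (s • θ + (y : E d))) ∧
            ∃ z : frontier Ω, (z : E d) = β • θ + (y : E d) ∧ g z = f β

/-- The directional trace `γ_θ u`: the set of all directional traces of `u` in the
direction `θ`. -/
def directionalTrace (Ω : Set (E d)) (θ : E d) (u : Lp ℝ 2 (volume.restrict Ω)) :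
    Set (frontier Ω → ℝ) :=
  {g | IsDirectionalTrace Ω θ u g}

/-- `δ_θ(x) = sup {s ≥ 0 : x + t θ ∈ Ω for all t ∈ [0, s[}`. -/
def exitTime (Ω : Set (E d)) (θ x : E d) : ℝ :=
  sSup {s : ℝ | 0 ≤ s ∧ ∀ t ∈ Ico 0 s, x + t • θ ∈ Ω}

/-- `Φ_θ(x) = x + δ_θ(x) θ`, the first point of `∂Ω` reached from `x ∈ Ω` in the
direction `θ`. -/
def exitPoint (Ω : Set (E d)) (θ x : E d) : E d :=
  x + exitTime Ω θ x • θ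

/-- The directional measure `μ_θ` on `∂Ω` (with its Borel σ-algebra): `μ_θ(A)` is the Lebesgue
measure of `{x ∈ Ω : Φ_θ(x) ∈ A}`; see `directionalMeasure_apply`. -/
def directionalMeasure (Ω : Set (E d)) (θ : E d) : Measure (frontier Ω) :=
  ((volume.restrict Ω).map (exitPoint Ω θ)).comap Subtype.val

theorem exitTime_bddAbove {Ω : Set (E d)} (hb : Bornology.IsBounded Ω) {θ : E d} (hθ : ‖θ‖ = 1)
    (x : E d) : BddAbove {s : ℝ | 0 ≤ s ∧ ∀ t ∈ Ico 0 s, x + t • θ ∈ Ω} := by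
  obtain ⟨R, hR⟩ := hb.subset_ball 0
  refine ⟨|R| + ‖x‖, fun s hs => ?_⟩
  by_contra! h
  have h0 : 0 ≤ |R| + ‖x‖ := by positivity
  have h1 := hR (hs.2 (|R| + ‖x‖) ⟨h0, h⟩)
  rw [Metric.mem_ball, dist_zero_right] at h1
  have h2 : ‖(|R| + ‖x‖) • θ‖ ≤ ‖x + (|R| + ‖x‖) • θ‖ + ‖x‖ := by
    have := norm_sub_le (x + (|R| + ‖x‖) • θ) x
    simpa using this
  rw [norm_smul, hθ, Real.norm_of_nonneg h0] at h2
  linarith [le_abs_self R]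

theorem lt_exitTime_iff {Ω : Set (E d)} (ho : IsOpen Ω) (hb : Bornology.IsBounded Ω) {θ : E d}
    (hθ : ‖θ‖ = 1) (x : E d) {c : ℝ} (hc : 0 ≤ c) :
    c < exitTime Ω θ x ↔ ∀ t ∈ Icc 0 c, x + t • θ ∈ Ω := by
  constructor
  · intro h t ht
    obtain ⟨s, hs, hcs⟩ := exists_lt_of_lt_csSup (by exact ⟨0, le_rfl, by simp⟩) h
    exact hs.2 t ⟨ht.1, ht.2.trans_lt hcs⟩
  · intro h
    have hopen : IsOpen {t : ℝ | x + t • θ ∈ Ω} := ho.preimage (by fun_prop)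
    obtain ⟨ε, hε, hball⟩ := Metric.isOpen_iff.1 hopen c (h c ⟨hc, le_rfl⟩)
    have hmem : c + ε ∈ {s : ℝ | 0 ≤ s ∧ ∀ t ∈ Ico 0 s, x + t • θ ∈ Ω} := by
      refine ⟨by linarith, fun t ht => ?_⟩
      rcases le_total t c with htc | htc
      · exact h t ⟨ht.1, htc⟩
      · refine hball ?_
        rw [Metric.mem_ball, Real.dist_eq, abs_of_nonneg (by linarith)]
        linarith [ht.2]
    exact lt_of_lt_of_le (by linarith) (le_csSup (exitTime_bddAbove hb hθ x) hmem)

theorem exitTime_nonneg (Ω : Set (E d)) (θ x : E d) : 0 ≤ exitTime Ω θ x :=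
  Real.sSup_nonneg fun _ hs => hs.1

theorem measurable_exitPoint {Ω : Set (E d)} (ho : IsOpen Ω) (hb : Bornology.IsBounded Ω)
    {θ : E d} (hθ : ‖θ‖ = 1) : Measurable (exitPoint Ω θ) := by
  have h : Measurable (exitTime Ω θ) := by
    refine measurable_of_Ioi fun c => ?_
    rcases lt_or_ge c 0 with hc | hc
    · have : exitTime Ω θ ⁻¹' Ioi c = univ :=
        eq_univ_of_forall fun x => hc.trans_le (exitTime_nonneg Ω θ x)
      rw [this]
      exact MeasurableSet.univ
    · have hcl : IsClosed (Prod.snd '' {p : Icc (0 : ℝ) c × E d | p.2 + (p.1 : ℝ) • θ ∈ Ωᶜ}) :=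
        isClosedMap_snd_of_compactSpace _ (ho.isClosed_compl.preimage (by fun_prop))
      have : exitTime Ω θ ⁻¹' Ioi c =
          (Prod.snd '' {p : Icc (0 : ℝ) c × E d | p.2 + (p.1 : ℝ) • θ ∈ Ωᶜ})ᶜ := by
        ext x
        rw [mem_preimage, mem_Ioi, lt_exitTime_iff ho hb hθ x hc]
        simp
      rw [this]
      exact hcl.measurableSet.compl
  unfold exitPoint
  exact measurable_id.add (h.smul_const θ)

theorem exitPoint_mem_frontier {Ω : Set (E d)} (ho : IsOpen Ω) (hb : Bornology.IsBounded Ω)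
    {θ : E d} (hθ : ‖θ‖ = 1) {x : E d} (hx : x ∈ Ω) : exitPoint Ω θ x ∈ frontier Ω := by
  have hpos : 0 < exitTime Ω θ x :=
    (lt_exitTime_iff ho hb hθ x le_rfl).2 fun t ht => by
      have : t = 0 := le_antisymm ht.2 ht.1
      simpa [this] using hx
  have hin : ∀ t ∈ Ico 0 (exitTime Ω θ x), x + t • θ ∈ Ω := fun t ht =>
    (lt_exitTime_iff ho hb hθ x ht.1).1 ht.2 t ⟨ht.1, le_rfl⟩
  rw [ho.frontier_eq]
  constructor
  · have hc : Continuous fun t : ℝ => x + t • θ := by fun_prop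
    have hm : exitTime Ω θ x ∈ closure (Ico 0 (exitTime Ω θ x)) := by
      rw [closure_Ico hpos.ne]
      exact ⟨hpos.le, le_rfl⟩
    exact map_mem_closure (f := fun t : ℝ => x + t • θ) hc hm hin
  · intro h
    refine lt_irrefl _ ((lt_exitTime_iff ho hb hθ x hpos.le).2 fun t ht => ?_)
    rcases ht.2.lt_or_eq with h' | h'
    · exact hin t ⟨ht.1, h'⟩
    · rw [h']
      exact h

theorem directionalMeasure_apply {Ω : Set (E d)} (ho : IsOpen Ω) (hb : Bornology.IsBounded Ω)
    {θ : E d} (hθ : ‖θ‖ = 1) {A : Set (frontier Ω)} (hA : MeasurableSet A) :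
    directionalMeasure Ω θ A =
      ∫⁻ x in Ω, (Subtype.val '' A).indicator (fun _ => (1 : ℝ≥0∞)) (exitPoint Ω θ x) := by
  have hF : MeasurableSet (frontier Ω) := isClosed_frontier.measurableSet
  have hA' : MeasurableSet (Subtype.val '' A : Set (E d)) := hF.subtype_image hA
  have hm := measurable_exitPoint ho hb hθ
  rw [directionalMeasure, Measure.comap_apply _ Subtype.val_injective
    (fun s hs => hF.subtype_image hs) _ hA, ← lintegral_indicator_one hA']
  exact lintegral_map (measurable_one.indicator hA') hm

end DirTrace

end

noncomputable section

namespace DirTrace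

open Filter Topology

/-! ### Sobolev functions on an interval. -/

section Interval

variable {a b : ℝ}

/-! In the coordinates `(y, s) ↦ s θ + y`, Lebesgue measure is a multiple of `λ^{d-1} × ds`, and
`Φ_θ` is constant on each segment of each line, with value the right end point. Since a segment has
positive length, a property of boundary points holds `μ_θ`-a.e. exactly when it holds at all right
end points on almost every line (`ae_directionalMeasure_of_ae`, `ae_of_ae_directionalMeasure`).

This gives part 1. On almost every line the continuous representatives behind two traces agree a.e.
on each segment, hence at its right end. Conversely, changing a trace on a `μ_θ`-null set only costs
a null set of lines, to be removed from `A`.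

For existence, Fubini with test functions `η(y) ψ(s)` shows that almost every restriction of `u` to
a line has the restriction of `v` as weak derivative (`ae_memH1_slice`). The exceptional lines
depend on `ψ`, so countably many `ψ` must suffice (`exists_countable_testFunctions`). In one
variable an `H¹` function is a primitive plus a constant, hence continuous up to the end points. The
end value is also the limit of averages of `u` over short segments ending there. This formula needs
no choice of continuous representative and is Borel in the boundary point, so it defines a Borel
trace. -/

theorem exists_subset_Icc_of_isCompact_subset_Ioo (hab : a < b) {K : Set ℝ} (hK : IsCompact K)
    (hKs : K ⊆ Ioo a b) : ∃ c d, a < c ∧ d < b ∧ K ⊆ Icc c d := by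
  rcases K.eq_empty_or_nonempty with rfl | hne
  · obtain ⟨c, h1, h2⟩ := exists_between hab
    exact ⟨c, c, h1, h2, empty_subset _⟩
  · obtain ⟨c, hc⟩ := hK.exists_isLeast hne
    obtain ⟨d, hd⟩ := hK.exists_isGreatest hne
    exact ⟨c, d, (hKs hc.1).1, (hKs hd.1).2, fun x hx => ⟨hc.2 hx, hd.2 hx⟩⟩

theorem IsTestFunction.eq_zero {V : Type*} [NormedAddCommGroup V] [NormedSpace ℝ V]
    {Ω : Set V} {φ : V → ℝ} (hφ : IsTestFunction Ω φ) {x : V} (hx : x ∉ Ω) : φ x = 0 :=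
  image_eq_zero_of_notMem_tsupport fun h => hx (hφ.2.2 h)

theorem IsTestFunction.deriv_eq_zero {ω : Set ℝ} {φ : ℝ → ℝ} (hφ : IsTestFunction ω φ) {x : ℝ}
    (hx : x ∉ ω) : deriv φ x = 0 :=
  image_eq_zero_of_notMem_tsupport fun h => hx (hφ.2.2 (tsupport_deriv_subset h))

theorem IsTestFunction.continuous_deriv {ω : Set ℝ} {φ : ℝ → ℝ} (hφ : IsTestFunction ω φ) :
    Continuous (deriv φ) :=
  hφ.1.continuous_deriv (by simp)

theorem IsTestFunction.mono {V : Type*} [NormedAddCommGroup V] [NormedSpace ℝ V]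
    {Ω Ω' : Set V} {φ : V → ℝ} (hφ : IsTestFunction Ω φ) (h : Ω ⊆ Ω') : IsTestFunction Ω' φ :=
  ⟨hφ.1, hφ.2.1, hφ.2.2.trans h⟩

/-- The primitive from `-∞` vanishes to the left of the support of `ψ`; to its right it equals the
total integral, so mean zero is what makes the support compact. -/
theorem IsTestFunction.exists_primitive (hab : a < b) {ψ : ℝ → ℝ} (hψ : IsTestFunction (Ioo a b) ψ)
    (h0 : ∫ s, ψ s = 0) : ∃ φ, IsTestFunction (Ioo a b) φ ∧ deriv φ = ψ := by
  obtain ⟨c, d, hac, hdb, hs⟩ := exists_subset_Icc_of_isCompact_subset_Ioo hab hψ.2.1 hψ.2.2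
  have hc : Continuous ψ := hψ.1.continuous
  have hi : Integrable ψ := hc.integrable_of_hasCompactSupport hψ.2.1
  have hz : ∀ x, x ∉ Icc c d → ψ x = 0 := fun x hx =>
    image_eq_zero_of_notMem_tsupport fun h => hx (hs h)
  have hder : ∀ x, HasDerivAt (fun x => ∫ t in Iic x, ψ t) (ψ x) x := by
    intro x
    have e : (fun x => ∫ t in Iic x, ψ t) = fun x => (∫ t in Iic a, ψ t) + ∫ t in a..x, ψ t := by
      funext x
      rw [← intervalIntegral.integral_Iic_sub_Iic hi.integrableOn hi.integrableOn]
      ring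
    rw [e]
    exact (intervalIntegral.integral_hasDerivAt_right (hc.intervalIntegrable _ _)
      (hc.stronglyMeasurableAtFilter _ _) hc.continuousAt).const_add _
  have hd : deriv (fun x => ∫ t in Iic x, ψ t) = ψ := funext fun x => (hder x).deriv
  have hsub : tsupport (fun x => ∫ t in Iic x, ψ t) ⊆ Icc c d := by
    refine closure_minimal (fun x hx => ?_) isClosed_Icc
    by_contra hx'
    apply hx
    rcases lt_or_ge x c with h | h
    · refine setIntegral_eq_zero_of_forall_eq_zero fun t ht => hz t fun h' => ?_
      have : t ≤ x := ht
      linarith [h'.1]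
    · have hxd : d < x := by
        by_contra h'
        exact hx' ⟨h, not_lt.1 h'⟩
      refine (setIntegral_eq_integral_of_forall_compl_eq_zero fun t ht => ?_).trans h0
      refine hz t fun h' => ht ?_
      exact h'.2.trans hxd.le
  refine ⟨_, ⟨?_, ?_, hsub.trans fun x hx => ⟨hac.trans_le hx.1, hx.2.trans_lt hdb⟩⟩, hd⟩
  · rw [contDiff_infty_iff_deriv, hd]
    exact ⟨fun x => (hder x).differentiableAt, hψ.1⟩
  · exact HasCompactSupport.of_support_subset_isCompact isCompact_Icc (subset_closure.trans hsub)

theorem exists_testFunction_integral_eq_one (hab : a < b) :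
    ∃ h : ℝ → ℝ, IsTestFunction (Ioo a b) h ∧ ∫ s, h s = 1 := by
  let β : ContDiffBump ((a + b) / 2) := ⟨(b - a) / 8, (b - a) / 4, by linarith, by linarith⟩
  refine ⟨β.normed volume, ⟨β.contDiff_normed, β.hasCompactSupport_normed, ?_⟩, β.integral_normed⟩
  rw [β.tsupport_normed_eq, Real.closedBall_eq_Icc]
  intro x hx
  have h1 := hx.1
  have h2 := hx.2
  simp only [β] at h1 h2
  exact ⟨by linarith, by linarith⟩

/-- The lemma of du Bois-Reymond. -/
theorem ae_eq_const_of_integral_mul_deriv_eq_zero (hab : a < b) {k : ℝ → ℝ}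
    (hk : IntegrableOn k (Ioo a b))
    (h : ∀ φ, IsTestFunction (Ioo a b) φ → ∫ s in Ioo a b, k s * deriv φ s = 0) :
    ∃ C, ∀ᵐ s ∂(volume.restrict (Ioo a b)), k s = C := by
  obtain ⟨η, hη, hη1⟩ := exists_testFunction_integral_eq_one hab
  have him : ∀ {φ}, IsTestFunction (Ioo a b) φ → IntegrableOn (fun s => k s * φ s) (Ioo a b) := by
    intro φ hφ
    obtain ⟨C, hC⟩ := hφ.1.continuous.bounded_above_of_compact_support hφ.2.1
    exact hk.mul_bdd hφ.1.continuous.aestronglyMeasurable (ae_of_all _ hC)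
  set C := ∫ s in Ioo a b, k s * η s with hCdef
  refine ⟨C, (ae_restrict_iff' measurableSet_Ioo).2 ?_⟩
  have hC : IntegrableOn (fun _ : ℝ => C) (Ioo a b) := integrableOn_const (by simp)
  have key := isOpen_Ioo.ae_eq_zero_of_integral_contDiff_smul_eq_zero (μ := volume)
    (f := fun s => k s - C) (hk.sub hC).locallyIntegrableOn ?_
  · filter_upwards [key] with s hs hs'
    exact sub_eq_zero.1 (hs hs')
  intro ψ h1 h2 h3
  have hψ : IsTestFunction (Ioo a b) ψ := ⟨h1, h2, h3⟩
  have hψi : Integrable ψ := h1.continuous.integrable_of_hasCompactSupport h2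
  have hηi : Integrable η := hη.1.continuous.integrable_of_hasCompactSupport hη.2.1
  set m := ∫ s, ψ s with hm
  -- Subtracting `m η` removes the mean, so the difference is the derivative of a test function and
  -- `h` applies.
  have hχ : IsTestFunction (Ioo a b) (fun s => ψ s - m * η s) := by
    refine ⟨h1.sub (contDiff_const.mul hη.1), h2.sub (hη.2.1.mul_left), ?_⟩
    refine (tsupport_sub _ _).trans (union_subset h3 ?_)
    exact (tsupport_mul_subset_right).trans hη.2.2
  obtain ⟨φ, hφ, hφ'⟩ := hχ.exists_primitive hab (by
    rw [integral_sub hψi (hηi.const_mul m), integral_const_mul, hη1, ← hm]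
    ring)
  have e := h φ hφ
  rw [hφ'] at e
  have e1 : ∫ s in Ioo a b, k s * (ψ s - m * η s) =
      (∫ s in Ioo a b, k s * ψ s) - m * C := by
    rw [hCdef, ← integral_const_mul, ← integral_sub (him hψ) ((him hη).const_mul m)]
    congr 1 with s
    ring
  have e2 : ∫ s, ψ s • (k s - C) = ∫ s in Ioo a b, (k s * ψ s - C * ψ s) := by
    rw [setIntegral_eq_integral_of_forall_compl_eq_zero]
    · congr 1 with s
      simp only [smul_eq_mul]
      ring
    · intro s hs
      rw [hψ.eq_zero hs]
      ring
  have e3 : ∫ s in Ioo a b, ψ s = m :=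
    setIntegral_eq_integral_of_forall_compl_eq_zero fun s hs => hψ.eq_zero hs
  rw [e2, integral_sub (him hψ) (hψi.integrableOn.const_mul C), integral_const_mul, e3]
  rw [e1] at e
  linarith

/-- Integration by parts for absolutely continuous functions; the boundary terms vanish because `φ b
= 0` and the primitive starts at `a`. -/
theorem integral_primitive_mul_deriv (hab : a < b) {k : ℝ → ℝ} (hk : IntegrableOn k (Ioo a b))
    {φ : ℝ → ℝ} (hφ : IsTestFunction (Ioo a b) φ) :
    ∫ s in Ioo a b, (∫ t in a..s, k t) * deriv φ s = - ∫ s in Ioo a b, k s * φ s := by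
  have hki : IntervalIntegrable k volume a b := by
    rwa [intervalIntegrable_iff_integrableOn_Ioo_of_le hab.le]
  have h1 := hki.absolutelyContinuousOnInterval_intervalIntegral (c := a) left_mem_uIcc
  have h2 : AbsolutelyContinuousOnInterval φ a b :=
    ContDiffOn.absolutelyContinuousOnInterval (hφ.1.of_le (by simp)).contDiffOn
  have h3 := h1.integral_mul_deriv_eq_deriv_mul h2
  rw [hφ.eq_zero (by simp), intervalIntegral.integral_same] at h3
  have h4 : ∫ x in a..b, deriv (fun x => ∫ t in a..x, k t) x * φ x = ∫ x in a..b, k x * φ x := by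
    refine intervalIntegral.integral_congr_ae ?_
    filter_upwards [hki.ae_hasDerivAt_integral] with x hx hx'
    rw [(hx (uIoc_subset_uIcc hx') a left_mem_uIcc).deriv]
  rw [h4] at h3
  simp only [intervalIntegral.integral_of_le hab.le, integral_Ioc_eq_integral_Ioo] at h3
  rw [h3]
  ring

/-- A function of class `H¹` on `ω` has, on each interval of `ω`, a representative that is
continuous up to the end points. -/
theorem MemH1.exists_continuous {ω : Set ℝ} {f : ℝ → ℝ} (hf : MemH1 ω f)
    (hp : (a, b) ∈ intervals ω) :
    ∃ F : ℝ → ℝ, Continuous F ∧ ∀ᵐ s ∂(volume.restrict (Ioo a b)), F s = f s := by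
  obtain ⟨h2, k, hk2, hk⟩ := hf
  have hab : a < b := hp.1
  have hsub : Ioo a b ⊆ ω := hp.2.1
  have : IsFiniteMeasure (volume.restrict (Ioo a b)) := ⟨by simp⟩
  have hfi : IntegrableOn f (Ioo a b) :=
    (h2.mono_measure (Measure.restrict_mono hsub le_rfl)).integrable one_le_two
  have hki : IntegrableOn k (Ioo a b) :=
    (hk2.mono_measure (Measure.restrict_mono hsub le_rfl)).integrable one_le_two
  -- Cutting off outside `]a, b[` gives a function integrable on all of `ℝ`, so that its primitive
  -- is continuous everywhere, in particular at `b`.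
  set K := (Ioo a b).indicator k with hK
  have hKi : Integrable K := hki.integrable_indicator measurableSet_Ioo
  set P : ℝ → ℝ := fun s => ∫ t in a..s, K t with hP
  have hPc : Continuous P := intervalIntegral.continuous_primitive
    (fun _ _ => hKi.intervalIntegrable) a
  have hPi : IntegrableOn P (Ioo a b) :=
    (hPc.integrableOn_Icc (a := a) (b := b)).mono_set Ioo_subset_Icc_self
  -- `f` and `P` have the same weak derivative on `]a, b[`, so they differ by a constant.
  obtain ⟨C, hC⟩ := ae_eq_const_of_integral_mul_deriv_eq_zero hab (k := fun s => f s - P s)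
    (hfi.sub hPi) (by
      intro φ hφ
      obtain ⟨D, hD⟩ := hφ.continuous_deriv.bounded_above_of_compact_support hφ.2.1.deriv
      have e1 := hk φ (hφ.mono hsub)
      have e2 := integral_primitive_mul_deriv hab (k := K) hKi.integrableOn hφ
      have e3 : ∀ g : ℝ → ℝ, ∀ χ : ℝ → ℝ, (∀ s, s ∉ Ioo a b → χ s = 0) →
          ∫ s in ω, g s * χ s = ∫ s in Ioo a b, g s * χ s := by
        intro g χ hχ
        rw [setIntegral_eq_integral_of_forall_compl_eq_zero fun s hs => by
            rw [hχ s fun h => hs (hsub h), mul_zero],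
          setIntegral_eq_integral_of_forall_compl_eq_zero fun s hs => by rw [hχ s hs, mul_zero]]
      rw [e3 f _ fun s hs => hφ.deriv_eq_zero hs, e3 k _ fun s hs => hφ.eq_zero hs] at e1
      have e4 : ∫ s in Ioo a b, K s * φ s = ∫ s in Ioo a b, k s * φ s :=
        setIntegral_congr_fun measurableSet_Ioo fun s hs => by
          simp only [hK, indicator_of_mem hs]
      have hm := hφ.continuous_deriv.aestronglyMeasurable (μ := volume.restrict (Ioo a b))
      rw [← sub_self (-∫ s in Ioo a b, k s * φ s)]
      nth_rewrite 1 [← e1]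
      rw [← e4, ← e2, ← integral_sub (hfi.mul_bdd hm (ae_of_all _ hD))
        (hPi.mul_bdd hm (ae_of_all _ hD))]
      congr 1 with s
      ring)
  refine ⟨fun s => P s + C, hPc.add continuous_const, ?_⟩
  filter_upwards [hC] with s hs
  rw [← hs]
  ring

/-- The averages of `F` are difference quotients at `0` of `x ↦ ∫ t in 0..x, F (b - t)`, whose
derivative there is `F b`. They only see `F` up to null sets, so `h` may replace it. -/
theorem tendsto_average_left {F h : ℝ → ℝ} (hab : a < b) (hF : Continuous F)
    (hFh : ∀ᵐ s ∂(volume.restrict (Ioo a b)), F s = h s) :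
    Tendsto (fun n : ℕ => ((n : ℝ) + 1) * ∫ t in Ioo 0 ((n : ℝ) + 1)⁻¹, h (b - t)) atTop
      (𝓝 (F b)) := by
  have hlim : Tendsto (fun n : ℕ => ((n : ℝ) + 1)⁻¹) atTop (𝓝 0) := by
    simpa [one_div] using tendsto_one_div_add_atTop_nhds_zero_nat (𝕜 := ℝ)
  have hder : HasDerivAt (fun x => ∫ t in (0 : ℝ)..x, F (b - t)) (F b) 0 := by
    have hc : Continuous fun t => F (b - t) := by fun_prop
    simpa using intervalIntegral.integral_hasDerivAt_right (hc.intervalIntegrable 0 0)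
      (hc.stronglyMeasurableAtFilter _ _) hc.continuousAt
  have hsl := (hasDerivAt_iff_tendsto_slope.1 hder).comp
    (tendsto_nhdsWithin_iff.2 ⟨hlim, Eventually.of_forall fun n => by
      simp only [mem_compl_iff, mem_singleton_iff]
      positivity⟩)
  refine hsl.congr' ?_
  -- Once `1 / (n + 1) < b - a`, the segment of integration stays inside `]a, b[`.
  filter_upwards [hlim.eventually (gt_mem_nhds (sub_pos.2 hab))] with n hn
  have hn0 : 0 ≤ ((n : ℝ) + 1)⁻¹ := by positivity
  simp only [Function.comp_apply, slope_def_field, intervalIntegral.integral_same, sub_zero]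
  rw [intervalIntegral.integral_of_le hn0, integral_Ioc_eq_integral_Ioo, div_inv_eq_mul, mul_comm]
  congr 1
  refine setIntegral_congr_ae measurableSet_Ioo ?_
  have hq := (Measure.measurePreserving_sub_left volume b).quasiMeasurePreserving.ae
    ((ae_restrict_iff' measurableSet_Ioo).1 hFh)
  filter_upwards [hq] with t ht ht'
  exact ht ⟨by linarith [ht'.2], by linarith [ht'.1]⟩

end Interval

variable {d : ℕ}

/-! ### Decomposition of `ℝ^d` into lines parallel to `θ`. -/

section Fibers

variable {θ : E d}

/-- The orthogonal projection onto the hyperplane `H_θ`. -/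
abbrev proj (θ : E d) : E d →L[ℝ] H θ := (H θ).orthogonalProjectionOnto

theorem inner_coe_hyperplane (y : H θ) : inner ℝ θ (y : E d) = 0 :=
  Submodule.mem_orthogonal_singleton_iff_inner_right.1 y.2

theorem inner_smul_add_coe (hθ : ‖θ‖ = 1) (s : ℝ) (y : H θ) :
    inner ℝ θ (s • θ + (y : E d)) = s := by
  rw [inner_add_right, inner_smul_right, inner_coe_hyperplane, real_inner_self_eq_norm_sq, hθ]
  ring

theorem proj_smul_add_coe (s : ℝ) (y : H θ) : proj θ (s • θ + (y : E d)) = y := by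
  rw [map_add, map_smul, Submodule.orthogonalProjectionOnto_orthogonalComplement_singleton_eq_zero,
    Submodule.orthogonalProjectionOnto_mem_subspace_eq_self, smul_zero, zero_add]

theorem inner_smul_add_proj (hθ : ‖θ‖ = 1) (x : E d) :
    (inner ℝ θ x : ℝ) • θ + (proj θ x : E d) = x := by
  have h := Submodule.starProjection_add_starProjection_orthogonal (K := ℝ ∙ θ) x
  rwa [Submodule.starProjection_unit_singleton ℝ hθ] at h

/-- The coordinates `(y, s) ↦ s θ + y` of `ℝ^d`. -/
def fiberEquiv (hθ : ‖θ‖ = 1) : (H θ × ℝ) ≃L[ℝ] E d :=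
  LinearEquiv.toContinuousLinearEquiv
    { toFun := fun p => p.2 • θ + (p.1 : E d)
      invFun := fun x => (proj θ x, inner ℝ θ x)
      map_add' := fun p q => by
        simp only [Prod.fst_add, Prod.snd_add, Submodule.coe_add]
        module
      map_smul' := fun c p => by
        simp only [Prod.smul_fst, Prod.smul_snd, Submodule.coe_smul, RingHom.id_apply, smul_eq_mul]
        module
      left_inv := fun p => Prod.ext (proj_smul_add_coe _ _) (inner_smul_add_coe hθ _ _)
      right_inv := fun x => inner_smul_add_proj hθ x }

instance : (hyperplaneMeasure θ).IsAddHaarMeasure := by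
  unfold hyperplaneMeasure
  infer_instance

/-- Uniqueness of Haar measure. The value of `c` is irrelevant: only null sets, integrability and
the vanishing of integrals are transferred. -/
theorem exists_volume_eq_smul_map (hθ : ‖θ‖ = 1) : ∃ c : ℝ≥0∞, c ≠ 0 ∧ c ≠ ⊤ ∧
    (volume : Measure (E d)) =
      c • ((hyperplaneMeasure θ).prod volume).map (fiberEquiv hθ) :=
  ⟨_, ENNReal.coe_ne_zero.2 (Measure.addHaarScalarFactor_pos_of_isAddHaarMeasure _ _).ne',
    ENNReal.coe_ne_top, Measure.isAddLeftInvariant_eq_smul _ _⟩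

theorem quasiMeasurePreserving_fiberEquiv (hθ : ‖θ‖ = 1) :
    Measure.QuasiMeasurePreserving (fiberEquiv hθ) ((hyperplaneMeasure θ).prod volume) volume := by
  obtain ⟨c, hc, hct, h⟩ := exists_volume_eq_smul_map hθ
  refine ⟨(fiberEquiv hθ).continuous.measurable, ?_⟩
  rw [h]
  exact Measure.absolutelyContinuous_smul hc

theorem ae_ae_fiber (hθ : ‖θ‖ = 1) {p : E d → Prop} (h : ∀ᵐ x, p x) :
    ∀ᵐ y : H θ ∂(hyperplaneMeasure θ), ∀ᵐ s : ℝ, p (s • θ + (y : E d)) :=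
  Measure.ae_ae_of_ae_prod ((quasiMeasurePreserving_fiberEquiv hθ).ae h)

theorem quasiMeasurePreserving_proj (hθ : ‖θ‖ = 1) :
    Measure.QuasiMeasurePreserving (proj θ) volume (hyperplaneMeasure θ) := by
  obtain ⟨c, hc, hct, h⟩ := exists_volume_eq_smul_map hθ
  refine ⟨(proj θ).continuous.measurable, ?_⟩
  rw [h, Measure.map_smul, Measure.map_map (proj θ).continuous.measurable
    (fiberEquiv hθ).continuous.measurable]
  have e : proj θ ∘ fiberEquiv hθ = Prod.fst := funext fun p => proj_smul_add_coe _ _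
  rw [e]
  exact Measure.AbsolutelyContinuous.smul_left
    (Measure.quasiMeasurePreserving_fst (μ := hyperplaneMeasure θ) (ν := (volume : Measure ℝ))).2 c

theorem integrable_comp_fiberEquiv (hθ : ‖θ‖ = 1) {F : E d → ℝ} (hF : Integrable F) :
    Integrable (fun p : H θ × ℝ => F (p.2 • θ + (p.1 : E d)))
      ((hyperplaneMeasure θ).prod volume) := by
  obtain ⟨c, hc, hct, h⟩ := exists_volume_eq_smul_map hθ
  have hm := (fiberEquiv hθ).toHomeomorph.measurableEmbedding
  rw [h] at hF
  have h1 := (integrable_smul_measure hc hct).1 hF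
  exact (hm.integrable_map_iff).1 h1

theorem exists_integral_eq_mul_integral_integral (hθ : ‖θ‖ = 1) : ∃ c : ℝ, c ≠ 0 ∧
    ∀ F : E d → ℝ, Integrable F →
      ∫ x, F x = c * ∫ y, (∫ s : ℝ, F (s • θ + (y : E d))) ∂(hyperplaneMeasure θ) := by
  obtain ⟨c, hc, hct, h⟩ := exists_volume_eq_smul_map hθ
  have hm := (fiberEquiv hθ).toHomeomorph.measurableEmbedding
  refine ⟨c.toReal, (ENNReal.toReal_pos hc hct).ne', fun F hF => ?_⟩
  have h1 : ∫ x, F x = c.toReal * ∫ p, F (fiberEquiv hθ p) ∂((hyperplaneMeasure θ).prod volume) := by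
    conv_lhs => rw [h]
    rw [integral_smul_measure, smul_eq_mul]
    congr 1
    exact hm.integral_map F
  rw [h1]
  congr 1
  exact integral_prod _ (integrable_comp_fiberEquiv hθ hF)

end Fibers

/-! ### Exit points and the null sets of `μ_θ`. -/

section ExitPoint

variable {Ω : Set (E d)} {θ : E d}

theorem isOpen_slice (ho : IsOpen Ω) (y : H θ) : IsOpen (slice Ω θ y) :=
  ho.preimage (by fun_prop)

theorem isBounded_slice (hb : Bornology.IsBounded Ω) (hθ : ‖θ‖ = 1) (y : H θ) :
    Bornology.IsBounded (slice Ω θ y) := by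
  obtain ⟨R, hR⟩ := hb.subset_ball 0
  refine (Metric.isBounded_ball (x := (0 : ℝ)) (r := R)).subset fun s hs => ?_
  have h1 := hR hs
  rw [mem_ball_zero_iff] at h1 ⊢
  refine lt_of_le_of_lt ?_ h1
  have h2 := abs_real_inner_le_norm θ (s • θ + (y : E d))
  rwa [inner_smul_add_coe hθ, hθ, one_mul] at h2

theorem exists_mem_intervals (ho : IsOpen Ω) (hb : Bornology.IsBounded Ω) (hθ : ‖θ‖ = 1)
    {x : E d} (hx : x ∈ Ω) :
    ∃ a b, (a, b) ∈ intervals (slice Ω θ (proj θ x)) ∧ inner ℝ θ x ∈ Ioo a b := by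
  have h : (inner ℝ θ x : ℝ) ∈ slice Ω θ (proj θ x) := by
    change (inner ℝ θ x : ℝ) • θ + (proj θ x : E d) ∈ Ω
    rwa [inner_smul_add_proj hθ]
  rw [← iUnion_intervals (isOpen_slice ho _) (isBounded_slice hb hθ _)] at h
  obtain ⟨p, hp, hxp⟩ := mem_iUnion₂.1 h
  exact ⟨p.1, p.2, hp, hxp⟩

variable {y : H θ} {a b s : ℝ}

/-- The line stays in `Ω` from `s` up to `b`, and `b` is not in the slice, so the exit time is `b -
s`. -/
theorem exitPoint_of_mem_intervals (ho : IsOpen Ω) (hb : Bornology.IsBounded Ω) (hθ : ‖θ‖ = 1)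
    (hab : (a, b) ∈ intervals (slice Ω θ y)) (hs : s ∈ Ioo a b) :
    exitPoint Ω θ (s • θ + (y : E d)) = b • θ + (y : E d) := by
  have key : ∀ t : ℝ, (s • θ + (y : E d)) + t • θ = (s + t) • θ + (y : E d) := fun t => by module
  have he : exitTime Ω θ (s • θ + (y : E d)) = b - s := by
    refine eq_of_forall_lt_iff fun c => ?_
    rcases lt_or_ge c 0 with hc | hc
    · exact iff_of_true (hc.trans_le (exitTime_nonneg _ _ _)) (by linarith [hs.2])
    · rw [lt_exitTime_iff ho hb hθ _ hc]
      constructor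
      · intro h
        by_contra! hcb
        refine hab.2.2.2 ?_
        have := h (b - s) ⟨by linarith [hs.2], hcb⟩
        rw [key, add_sub_cancel] at this
        exact this
      · intro h t ht
        rw [key]
        exact hab.2.1 ⟨by linarith [hs.1, ht.1], by linarith [ht.2]⟩
  rw [exitPoint, he, key, add_sub_cancel]

theorem endpoint_mem_frontier (ho : IsOpen Ω) (hb : Bornology.IsBounded Ω) (hθ : ‖θ‖ = 1)
    (hab : (a, b) ∈ intervals (slice Ω θ y)) : b • θ + (y : E d) ∈ frontier Ω := by
  obtain ⟨s, hs⟩ := exists_between hab.1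
  rw [← exitPoint_of_mem_intervals ho hb hθ hab hs]
  exact exitPoint_mem_frontier ho hb hθ (hab.2.1 hs)

/-- The part of `∂Ω` that is reached from `Ω` in the direction `θ`. -/
def exitBoundary (Ω : Set (E d)) (θ : E d) : Set (frontier Ω) :=
  {z | ∃ x ∈ Ω, exitPoint Ω θ x = z}

theorem exists_of_mem_exitBoundary (ho : IsOpen Ω) (hb : Bornology.IsBounded Ω) (hθ : ‖θ‖ = 1)
    {z : frontier Ω} (hz : z ∈ exitBoundary Ω θ) :
    ∃ a b, proj θ z ∈ shadow Ω θ ∧ (a, b) ∈ intervals (slice Ω θ (proj θ z)) ∧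
      (z : E d) = b • θ + (proj θ z : E d) := by
  obtain ⟨x, hx, hxz⟩ := hz
  obtain ⟨a, b, hab, hs⟩ := exists_mem_intervals ho hb hθ hx
  have h := exitPoint_of_mem_intervals ho hb hθ hab hs
  rw [inner_smul_add_proj hθ, hxz] at h
  have hp : proj θ z = proj θ x := by rw [h, proj_smul_add_coe]
  rw [hp]
  exact ⟨a, b, ⟨x, hx, rfl⟩, hab, h⟩

/-- The definition quantifies over uncountably many starting points, but a reached point `z` is
already reached from some `z - θ / (n + 1)`, which leaves a countable union of Borel conditions on
`z`. -/
theorem measurableSet_exitBoundary (ho : IsOpen Ω) (hb : Bornology.IsBounded Ω) (hθ : ‖θ‖ = 1) :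
    MeasurableSet (exitBoundary Ω θ) := by
  have e : exitBoundary Ω θ = ⋃ n : ℕ, {z : frontier Ω |
      (z : E d) - ((n : ℝ) + 1)⁻¹ • θ ∈ Ω ∧
        exitPoint Ω θ ((z : E d) - ((n : ℝ) + 1)⁻¹ • θ) = z} := by
    ext z
    simp only [mem_iUnion]
    constructor
    · intro hz
      obtain ⟨a, b, -, hab, hz⟩ := exists_of_mem_exitBoundary ho hb hθ hz
      obtain ⟨n, hn⟩ := exists_nat_one_div_lt (sub_pos.2 hab.1)
      rw [one_div] at hn
      have hs : b - ((n : ℝ) + 1)⁻¹ ∈ Ioo a b := ⟨by simp only at hn; linarith, by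
        have : 0 < ((n : ℝ) + 1)⁻¹ := by positivity
        linarith⟩
      have h1 : (z : E d) - ((n : ℝ) + 1)⁻¹ • θ =
          (b - ((n : ℝ) + 1)⁻¹) • θ + (proj θ z : E d) := by
        nth_rewrite 1 [hz]
        module
      refine ⟨n, ?_, ?_⟩
      · rw [h1]
        exact hab.2.1 hs
      · rw [h1, exitPoint_of_mem_intervals ho hb hθ hab hs, ← hz]
    · rintro ⟨n, h1, h2⟩
      exact ⟨_, h1, h2⟩
  rw [e]
  refine MeasurableSet.iUnion fun n => ?_
  have hm : Measurable fun z : frontier Ω => (z : E d) - ((n : ℝ) + 1)⁻¹ • θ :=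
    measurable_subtype_coe.sub_const _
  exact (hm ho.measurableSet).inter
    (measurableSet_eq_fun ((measurable_exitPoint ho hb hθ).comp hm) measurable_subtype_coe)

theorem directionalMeasure_eq (ho : IsOpen Ω) (hb : Bornology.IsBounded Ω) (hθ : ‖θ‖ = 1)
    {A : Set (frontier Ω)} (hA : MeasurableSet A) :
    directionalMeasure Ω θ A = volume ({x | exitPoint Ω θ x ∈ Subtype.val '' A} ∩ Ω) := by
  have hF : MeasurableSet (frontier Ω) := isClosed_frontier.measurableSet
  have hA' : MeasurableSet (Subtype.val '' A : Set (E d)) := hF.subtype_image hA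
  have hm := measurable_exitPoint ho hb hθ
  rw [directionalMeasure, Measure.comap_apply _ Subtype.val_injective
    (fun s hs => hF.subtype_image hs) _ hA, Measure.map_apply hm hA',
    Measure.restrict_apply (hm hA')]
  rfl

/-- A property of the boundary point that holds on almost all lines in the direction `θ` holds
`μ_θ`-almost everywhere. -/
theorem ae_directionalMeasure_of_ae (ho : IsOpen Ω) (hb : Bornology.IsBounded Ω) (hθ : ‖θ‖ = 1)
    {p : frontier Ω → Prop}
    (h : ∀ᵐ y : H θ ∂(hyperplaneMeasure θ), y ∈ shadow Ω θ →
      ∀ a b, (a, b) ∈ intervals (slice Ω θ y) → ∀ z : frontier Ω, (z : E d) = b • θ + (y : E d) → p z) :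
    ∀ᵐ z : frontier Ω ∂(directionalMeasure Ω θ), p z := by
  obtain ⟨N, hN, hNm, hN0⟩ := exists_measurable_superset_of_null (ae_iff.1 h)
  have h1 : ∀ᵐ z : frontier Ω ∂(directionalMeasure Ω θ), z ∈ exitBoundary Ω θ := by
    refine ae_iff.2 ?_
    -- No point of `Ω` exits outside `exitBoundary`, so the preimage is empty.
    change directionalMeasure Ω θ (exitBoundary Ω θ)ᶜ = 0
    rw [directionalMeasure_eq ho hb hθ (measurableSet_exitBoundary ho hb hθ).compl]
    convert measure_empty (μ := (volume : Measure (E d)))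
    refine eq_empty_of_forall_notMem ?_
    rintro x ⟨⟨z, hz, hzx⟩, hx⟩
    exact hz ⟨x, hx, hzx.symm⟩
  have hm : Measurable fun z : frontier Ω => proj θ z :=
    (proj θ).continuous.measurable.comp measurable_subtype_coe
  have h2 : ∀ᵐ z : frontier Ω ∂(directionalMeasure Ω θ), proj θ z ∉ N := by
    refine ae_iff.2 ?_
    simp only [not_not]
    change directionalMeasure Ω θ ((fun z : frontier Ω => proj θ z) ⁻¹' N) = 0
    rw [directionalMeasure_eq ho hb hθ (hm hNm)]
    -- `Φ_θ` moves points along `θ` only, so `x` and its exit point have the same projection.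
    refine measure_mono_null ?_ ((quasiMeasurePreserving_proj hθ).preimage_null hN0)
    rintro x ⟨⟨z, hz, hzx⟩, hx⟩
    have h3 : proj θ z ∈ N := hz
    rw [hzx] at h3
    rwa [exitPoint, map_add, map_smul,
      Submodule.orthogonalProjectionOnto_orthogonalComplement_singleton_eq_zero, smul_zero,
      add_zero] at h3
  filter_upwards [h1, h2] with z hz1 hz2
  obtain ⟨a, b, hs, hab, hz⟩ := exists_of_mem_exitBoundary ho hb hθ hz1
  by_contra hp
  exact hz2 (hN fun h => hp (h hs a b hab z hz))

/-- A property that holds `μ_θ`-almost everywhere holds at all the end points on almost all lines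
in the direction `θ`. -/
theorem ae_of_ae_directionalMeasure (ho : IsOpen Ω) (hb : Bornology.IsBounded Ω) (hθ : ‖θ‖ = 1)
    {p : frontier Ω → Prop} (h : ∀ᵐ z : frontier Ω ∂(directionalMeasure Ω θ), p z) :
    ∀ᵐ y : H θ ∂(hyperplaneMeasure θ), ∀ a b, (a, b) ∈ intervals (slice Ω θ y) →
      ∀ z : frontier Ω, (z : E d) = b • θ + (y : E d) → p z := by
  obtain ⟨N, hN, hNm, hN0⟩ := exists_measurable_superset_of_null (ae_iff.1 h)
  rw [directionalMeasure_eq ho hb hθ hNm] at hN0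
  filter_upwards [ae_ae_fiber hθ (measure_eq_zero_iff_ae_notMem.1 hN0)] with y hy a b hab z hz
  by_contra hp
  -- A bad end point would put the whole segment `]a, b[` into a null subset of the line.
  have h1 : ∀ᵐ s : ℝ, s ∉ Ioo a b := by
    filter_upwards [hy] with s hs hsab
    refine hs ⟨?_, hab.2.1 hsab⟩
    change exitPoint Ω θ (s • θ + (y : E d)) ∈ Subtype.val '' N
    rw [exitPoint_of_mem_intervals ho hb hθ hab hsab, ← hz]
    exact mem_image_of_mem _ (hN hp)
  have h2 := measure_eq_zero_iff_ae_notMem.2 h1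
  rw [Real.volume_Ioo, ENNReal.ofReal_eq_zero] at h2
  have := hab.1
  simp only at this
  linarith

end ExitPoint

/-! ### Reduction to countably many test functions. -/

section CountableTests

theorem continuous_integral_mul_restrict {K : Set ℝ} (hK : IsCompact K) {f : ℝ → ℝ}
    (hf : Integrable f) :
    Continuous fun p : C(K, ℝ) => ∫ s : K, f s * p s ∂(volume.comap Subtype.val) := by
  have : CompactSpace K := isCompact_iff_compactSpace.1 hK
  have hfi : Integrable (fun s : K => f s) (volume.comap Subtype.val) :=
    (integrableOn_iff_comap_subtypeVal hK.measurableSet).1 hf.integrableOn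
  refine continuous_iff_continuousAt.2 fun p₀ => ?_
  refine continuousAt_of_dominated (bound := fun s => |f s| * (‖p₀‖ + 1)) ?_ ?_ ?_ ?_
  · exact Eventually.of_forall fun p => hfi.1.mul p.continuous.aestronglyMeasurable
  · have h : ∀ᶠ p in 𝓝 p₀, ‖p‖ < ‖p₀‖ + 1 :=
      continuous_norm.continuousAt.eventually (gt_mem_nhds (by simp))
    filter_upwards [h] with p hp
    refine ae_of_all _ fun s => ?_
    rw [norm_mul, Real.norm_eq_abs]
    exact mul_le_mul_of_nonneg_left ((p.norm_coe_le_norm s).trans hp.le) (abs_nonneg _)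
  · exact hfi.abs.mul_const _
  · exact ae_of_all _ fun s =>
      (continuous_const.mul (continuous_eval_const s)).continuousAt

/-- Countably many test functions supported in a compact set suffice to test a weak derivative. -/
theorem exists_countable_testFunctions {K : Set ℝ} (hK : IsCompact K) :
    ∃ D : Set (ℝ → ℝ), D.Countable ∧ (∀ φ ∈ D, IsTestFunction K φ) ∧
      ∀ f g : ℝ → ℝ, Integrable f → Integrable g →
        (∀ φ ∈ D, ∫ s, (f s * deriv φ s + g s * φ s) = 0) →
        ∀ φ, IsTestFunction K φ → ∫ s, (f s * deriv φ s + g s * φ s) = 0 := by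
  have : CompactSpace K := isCompact_iff_compactSpace.1 hK
  let X := {φ : ℝ → ℝ // IsTestFunction K φ}
  let j : X → C(K, ℝ) × C(K, ℝ) := fun φ =>
    (⟨fun s => deriv φ.1 s, φ.2.continuous_deriv.comp continuous_subtype_val⟩,
      ⟨fun s => φ.1 s, φ.2.1.continuous.comp continuous_subtype_val⟩)
  -- Uniform convergence of `φ` and `φ'` on `K`. It is second countable, being induced from `C(K) ×
  -- C(K)`, and makes the tested integral continuous in `φ`, so a countable dense set decides.
  let τ : TopologicalSpace X := TopologicalSpace.induced j inferInstance
  have hj : Continuous j := continuous_induced_dom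
  have : SecondCountableTopology X := TopologicalSpace.secondCountableTopology_induced _ _ j
  obtain ⟨D, hDc, hD⟩ := TopologicalSpace.exists_countable_dense X
  refine ⟨Subtype.val '' D, hDc.image _, ?_, fun f g hf hg h φ hφ => ?_⟩
  · rintro _ ⟨φ, -, rfl⟩
    exact φ.2
  have key : ∀ φ : X, ∫ s, (f s * deriv φ.1 s + g s * φ.1 s) =
      (∫ s : K, f s * (j φ).1 s ∂(volume.comap Subtype.val)) +
        ∫ s : K, g s * (j φ).2 s ∂(volume.comap Subtype.val) := by
    intro φ
    obtain ⟨C, hC⟩ := φ.2.1.continuous.bounded_above_of_compact_support φ.2.2.1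
    obtain ⟨C', hC'⟩ := φ.2.continuous_deriv.bounded_above_of_compact_support φ.2.2.1.deriv
    rw [integral_add
      (hf.mul_bdd φ.2.continuous_deriv.aestronglyMeasurable (ae_of_all _ hC'))
      (hg.mul_bdd φ.2.1.continuous.aestronglyMeasurable (ae_of_all _ hC))]
    have e1 := integral_subtype_comap (μ := volume) hK.measurableSet
      (fun s => f s * deriv φ.1 s)
    have e2 := integral_subtype_comap (μ := volume) hK.measurableSet (fun s => g s * φ.1 s)
    rw [setIntegral_eq_integral_of_forall_compl_eq_zero fun s hs => by
      rw [φ.2.deriv_eq_zero hs, mul_zero]] at e1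
    rw [setIntegral_eq_integral_of_forall_compl_eq_zero fun s hs => by
      rw [φ.2.eq_zero hs, mul_zero]] at e2
    rw [← e1, ← e2]
    rfl
  have hcont : Continuous fun φ : X => ∫ s, (f s * deriv φ.1 s + g s * φ.1 s) := by
    simp_rw [key]
    exact ((continuous_integral_mul_restrict hK hf).comp (continuous_fst.comp hj)).add
      ((continuous_integral_mul_restrict hK hg).comp (continuous_snd.comp hj))
  have hall := hcont.ext_on hD continuous_const fun φ hφ => h _ (mem_image_of_mem _ hφ)
  exact congrFun hall ⟨φ, hφ⟩

/-- The finite unions of compact intervals with rational end points. -/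
def rationalUnion (t : Finset (ℚ × ℚ)) : Set ℝ := ⋃ p ∈ t, Icc (p.1 : ℝ) p.2

theorem isCompact_rationalUnion (t : Finset (ℚ × ℚ)) : IsCompact (rationalUnion t) :=
  t.isCompact_biUnion fun _ _ => isCompact_Icc

/-- Provides one countable family of compact sets serving all slices at once, although the slices
vary with `y`. -/
theorem exists_rationalUnion {ω L : Set ℝ} (ho : IsOpen ω) (hL : IsCompact L) (h : L ⊆ ω) :
    ∃ t, L ⊆ rationalUnion t ∧ rationalUnion t ⊆ ω := by
  refine hL.induction_on (p := fun s => ∃ t, s ⊆ rationalUnion t ∧ rationalUnion t ⊆ ω)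
    ⟨∅, by simp [rationalUnion]⟩ (fun s s' hs ⟨t, h1, h2⟩ => ⟨t, hs.trans h1, h2⟩) ?_ ?_
  · rintro s s' ⟨t, h1, h2⟩ ⟨t', h1', h2'⟩
    have e : rationalUnion (t ∪ t') = rationalUnion t ∪ rationalUnion t' :=
      Finset.set_biUnion_union _ _ _
    exact ⟨t ∪ t', e ▸ union_subset_union h1 h1', e ▸ union_subset h2 h2'⟩
  · intro x hx
    obtain ⟨ε, hε, hball⟩ := Metric.isOpen_iff.1 ho x (h hx)
    obtain ⟨p, hp1, hp2⟩ := exists_rat_btwn (show x - ε < x by linarith)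
    obtain ⟨q, hq1, hq2⟩ := exists_rat_btwn (show x < x + ε by linarith)
    have e : rationalUnion {(p, q)} = Icc (p : ℝ) q := by simp [rationalUnion]
    refine ⟨Icc p q, mem_nhdsWithin_of_mem_nhds (Icc_mem_nhds hp2 hq1), {(p, q)}, e.ge, ?_⟩
    rw [e]
    refine Subset.trans (fun s hs => ?_) hball
    rw [Real.ball_eq_Ioo]
    exact ⟨hp1.trans_le hs.1, hs.2.trans_lt hq2⟩

end CountableTests

/-! ### Weak derivatives on almost every line. -/

section Slicing

variable {Ω : Set (E d)} {θ : E d} {U V : E d → ℝ}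

theorem isOpen_setOf_subset_slice (ho : IsOpen Ω) {K : Set ℝ} (hK : IsCompact K) :
    IsOpen {y : H θ | K ⊆ slice Ω θ y} := by
  have : {y : H θ | K ⊆ slice Ω θ y} = {y : H θ | ∀ s ∈ K, s • θ + (y : E d) ∈ Ω} := rfl
  rw [this]
  have hc : Continuous fun p : H θ × ℝ => p.2 • θ + (p.1 : E d) := by fun_prop
  refine isOpen_iff_mem_nhds.2 fun y hy => ?_
  refine hK.eventually_forall_of_forall_eventually fun s hs => ?_
  exact hc.continuousAt.eventually (ho.mem_nhds (hy s hs))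

theorem IsTestFunction.tensor (hθ : ‖θ‖ = 1) {K : Set ℝ} {η : H θ → ℝ} {ψ : ℝ → ℝ}
    (hη : IsTestFunction {y : H θ | K ⊆ slice Ω θ y} η) (hψ : IsTestFunction K ψ) :
    IsTestFunction Ω fun x => η (proj θ x) * ψ (inner ℝ θ x) := by
  set C := fiberEquiv hθ '' (tsupport η ×ˢ tsupport ψ) with hC
  have hCc : IsCompact C := (IsCompact.prod hη.2.1 hψ.2.1).image (fiberEquiv hθ).continuous
  have hsub : tsupport (fun x => η (proj θ x) * ψ (inner ℝ θ x)) ⊆ C := by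
    refine closure_minimal (fun x hx => ?_) hCc.isClosed
    have h1 : η (proj θ x) ≠ 0 := left_ne_zero_of_mul hx
    have h2 : ψ (inner ℝ θ x) ≠ 0 := right_ne_zero_of_mul hx
    exact ⟨(proj θ x, inner ℝ θ x), ⟨subset_tsupport _ h1, subset_tsupport _ h2⟩,
      inner_smul_add_proj hθ x⟩
  refine ⟨(hη.1.comp (proj θ).contDiff).mul (hψ.1.comp (contDiff_const.inner ℝ contDiff_id)),
    HasCompactSupport.of_support_subset_isCompact hCc (subset_closure.trans hsub),
    hsub.trans ?_⟩
  rintro _ ⟨⟨y, s⟩, ⟨hy, hs⟩, rfl⟩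
  exact hη.2.2 hy (hψ.2.2 hs)

/-- The factor `η (proj θ x)` is constant in the direction `θ`. -/
theorem lineDeriv_tensor (hθ : ‖θ‖ = 1) (η : H θ → ℝ) {ψ : ℝ → ℝ} (hψ : Differentiable ℝ ψ)
    (x : E d) : lineDeriv ℝ (fun x => η (proj θ x) * ψ (inner ℝ θ x)) x θ =
      η (proj θ x) * deriv ψ (inner ℝ θ x) := by
  have e : (fun t : ℝ => η (proj θ (x + t • θ)) * ψ (inner ℝ θ (x + t • θ))) =
      fun t => η (proj θ x) * ψ (inner ℝ θ x + t) := by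
    funext t
    rw [map_add, map_smul,
      Submodule.orthogonalProjectionOnto_orthogonalComplement_singleton_eq_zero, smul_zero,
      add_zero, inner_add_right, inner_smul_right, real_inner_self_eq_norm_sq, hθ]
    simp
  rw [lineDeriv, e]
  have h := ((hψ (inner ℝ θ x + 0)).hasDerivAt.comp_const_add (inner ℝ θ x) 0).const_mul
    (η (proj θ x))
  rw [h.deriv, add_zero]

theorem integrable_mul_comp_inner {F : E d → ℝ} (hF : Integrable F) {χ : ℝ → ℝ}
    (hχ : Continuous χ) (hc : HasCompactSupport χ) :
    Integrable fun x => F x * χ (inner ℝ θ x) := by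
  obtain ⟨C, hC⟩ := hχ.bounded_above_of_compact_support hc
  exact hF.mul_bdd (by fun_prop) (ae_of_all _ fun x => hC _)

/-- The lines whose slice contains `K` form an open set of `y`. For `η` supported there, `η(y) ψ(s)`
is a test function on `Ω`; Fubini shows that the line integral is orthogonal to every such `η`,
hence zero a.e. on that set. -/
theorem ae_integral_slice_eq_zero (ho : IsOpen Ω) (hθ : ‖θ‖ = 1) (hU : Integrable U)
    (hV : Integrable V)
    (h : ∀ φ, IsTestFunction Ω φ → ∫ x, U x * lineDeriv ℝ φ x θ = - ∫ x, V x * φ x)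
    {K : Set ℝ} (hK : IsCompact K) {ψ : ℝ → ℝ} (hψ : IsTestFunction K ψ) :
    ∀ᵐ y : H θ ∂(hyperplaneMeasure θ), K ⊆ slice Ω θ y →
      ∫ s : ℝ, (U (s • θ + (y : E d)) * deriv ψ s + V (s • θ + (y : E d)) * ψ s) = 0 := by
  have h1 : Integrable fun x => U x * deriv ψ (inner ℝ θ x) :=
    integrable_mul_comp_inner hU hψ.continuous_deriv hψ.2.1.deriv
  have h2 : Integrable fun x => V x * ψ (inner ℝ θ x) :=
    integrable_mul_comp_inner hV hψ.1.continuous hψ.2.1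
  have hint := (integrable_comp_fiberEquiv hθ (h1.add h2)).integral_prod_left
  simp only [Pi.add_apply, inner_smul_add_coe hθ] at hint
  refine (isOpen_setOf_subset_slice ho hK).ae_eq_zero_of_integral_contDiff_smul_eq_zero
    (hint.locallyIntegrable.locallyIntegrableOn _) fun η g1 g2 g3 => ?_
  have hη : IsTestFunction {y : H θ | K ⊆ slice Ω θ y} η := ⟨g1, g2, g3⟩
  obtain ⟨C, hC⟩ := g1.continuous.bounded_above_of_compact_support g2
  have hm : AEStronglyMeasurable (fun x : E d => η (proj θ x)) volume :=
    (g1.continuous.comp (proj θ).continuous).aestronglyMeasurable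
  have h3 := h1.mul_bdd hm (ae_of_all _ fun x => hC (proj θ x))
  have h4 := h2.mul_bdd hm (ae_of_all _ fun x => hC (proj θ x))
  have e := h _ (IsTestFunction.tensor hθ hη hψ)
  simp only [lineDeriv_tensor hθ η (hψ.1.differentiable (by simp))] at e
  have e0 : ∫ x, (U x * deriv ψ (inner ℝ θ x) * η (proj θ x) +
      V x * ψ (inner ℝ θ x) * η (proj θ x)) = 0 := by
    rw [integral_add h3 h4]
    have e1 : ∀ x, U x * (η (proj θ x) * deriv ψ (inner ℝ θ x)) =
      U x * deriv ψ (inner ℝ θ x) * η (proj θ x) := fun x => by ring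
    have e2 : ∀ x, V x * (η (proj θ x) * ψ (inner ℝ θ x)) =
      V x * ψ (inner ℝ θ x) * η (proj θ x) := fun x => by ring
    simp only [e1, e2] at e
    rw [e, neg_add_cancel]
  obtain ⟨c, hc, hcF⟩ := exists_integral_eq_mul_integral_integral hθ
  have e4 := hcF (fun x => U x * deriv ψ (inner ℝ θ x) * η (proj θ x) +
    V x * ψ (inner ℝ θ x) * η (proj θ x)) (h3.add h4)
  rw [e4] at e0
  have e3 := (mul_eq_zero.1 e0).resolve_left hc
  rw [← e3]
  congr 1 with y
  rw [smul_eq_mul, ← integral_const_mul]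
  congr 1 with s
  rw [proj_smul_add_coe, inner_smul_add_coe hθ]
  ring

/-- On almost all lines in the direction `θ`, the weak derivative in the direction `θ` is the weak
derivative of the restriction to the line. -/
theorem ae_memH1_slice (ho : IsOpen Ω) (hθ : ‖θ‖ = 1) (hU : Integrable U) (hV : Integrable V)
    (hUm : StronglyMeasurable U) (hVm : StronglyMeasurable V)
    (hU2 : MemLp U 2) (hV2 : MemLp V 2)
    (h : ∀ φ, IsTestFunction Ω φ → ∫ x, U x * lineDeriv ℝ φ x θ = - ∫ x, V x * φ x) :
    ∀ᵐ y : H θ ∂(hyperplaneMeasure θ), MemH1 (slice Ω θ y) fun s => U (s • θ + (y : E d)) := by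
  choose D hDc hDt hD using fun t : Finset (ℚ × ℚ) =>
    exists_countable_testFunctions (isCompact_rationalUnion t)
  have h1 : ∀ᵐ y : H θ ∂(hyperplaneMeasure θ), ∀ t, ∀ ψ ∈ D t, rationalUnion t ⊆ slice Ω θ y →
      ∫ s : ℝ, (U (s • θ + (y : E d)) * deriv ψ s + V (s • θ + (y : E d)) * ψ s) = 0 :=
    ae_all_iff.2 fun t => (ae_ball_iff (hDc t)).2 fun ψ hψ =>
      ae_integral_slice_eq_zero ho hθ hU hV h (isCompact_rationalUnion t) (hDt t ψ hψ)
  have hline : ∀ y : H θ, Measurable fun s : ℝ => s • θ + (y : E d) := fun y => by fun_prop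
  have h2 := (integrable_comp_fiberEquiv hθ hU).prod_right_ae
  have h3 := (integrable_comp_fiberEquiv hθ hV).prod_right_ae
  have h4 := (integrable_comp_fiberEquiv hθ hU2.integrable_sq).prod_right_ae
  have h5 := (integrable_comp_fiberEquiv hθ hV2.integrable_sq).prod_right_ae
  filter_upwards [h1, h2, h3, h4, h5] with y h1 h2 h3 h4 h5
  have m1 : MemLp (fun s => U (s • θ + (y : E d))) 2 (volume : Measure ℝ) :=
    (memLp_two_iff_integrable_sq (hUm.comp_measurable (hline y)).aestronglyMeasurable).2 h4
  have m2 : MemLp (fun s => V (s • θ + (y : E d))) 2 (volume : Measure ℝ) :=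
    (memLp_two_iff_integrable_sq (hVm.comp_measurable (hline y)).aestronglyMeasurable).2 h5
  refine ⟨m1.restrict _, _, m2.restrict _, fun φ hφ => ?_⟩
  -- The line `y` is fixed before `φ`; the support of `φ` selects a member of the countable family,
  -- for which `y` is already known to be good.
  obtain ⟨t, ht1, ht2⟩ := exists_rationalUnion (isOpen_slice ho y) hφ.2.1 hφ.2.2
  have e := hD t _ _ h2 h3 (fun ψ hψ => h1 t ψ hψ ht2) φ ⟨hφ.1, hφ.2.1, ht1⟩
  obtain ⟨C, hC⟩ := hφ.1.continuous.bounded_above_of_compact_support hφ.2.1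
  obtain ⟨C', hC'⟩ := hφ.continuous_deriv.bounded_above_of_compact_support hφ.2.1.deriv
  rw [integral_add (h2.mul_bdd hφ.continuous_deriv.aestronglyMeasurable (ae_of_all _ hC'))
    (h3.mul_bdd hφ.1.continuous.aestronglyMeasurable (ae_of_all _ hC))] at e
  rw [setIntegral_eq_integral_of_forall_compl_eq_zero fun s hs => by
      rw [hφ.deriv_eq_zero hs, mul_zero],
    setIntegral_eq_integral_of_forall_compl_eq_zero fun s hs => by
      rw [hφ.eq_zero hs, mul_zero]]
  exact eq_neg_of_add_eq_zero_left e

end Slicing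

/-! ### Uniqueness, stability and existence of the trace. -/

variable {Ω : Set (E d)} {θ : E d} {u : Lp ℝ 2 (volume.restrict Ω)}

/-- Two directional traces of the same function agree `μ_θ`-almost everywhere. -/
theorem IsDirectionalTrace.ae_eq (ho : IsOpen Ω) (hb : Bornology.IsBounded Ω) (hθ : ‖θ‖ = 1)
    {g g' : frontier Ω → ℝ} (h : IsDirectionalTrace Ω θ u g) (h' : IsDirectionalTrace Ω θ u g') :
    ∀ᵐ z : frontier Ω ∂(directionalMeasure Ω θ), g' z = g z := by
  obtain ⟨w, hw, A, -, hA, hg⟩ := h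
  obtain ⟨w', hw', A', -, hA', hg'⟩ := h'
  have hww : ∀ᵐ x, x ∈ Ω → w x = w' x :=
    (ae_restrict_iff' ho.measurableSet).1 (hw.trans hw'.symm)
  refine ae_directionalMeasure_of_ae ho hb hθ ?_
  filter_upwards [ae_ae_fiber hθ hww, measure_eq_zero_iff_ae_notMem.1 hA,
    measure_eq_zero_iff_ae_notMem.1 hA'] with y hy hyA hyA' hys a b hab z hz
  have hyA : y ∈ A := by_contra fun h => hyA ⟨hys, h⟩
  have hyA' : y ∈ A' := by_contra fun h => hyA' ⟨hys, h⟩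
  obtain ⟨f, hfc, hf, z₁, hz₁, hgz⟩ := (hg y hyA).2 a b hab
  obtain ⟨f', hfc', hf', z₂, hz₂, hgz'⟩ := (hg' y hyA').2 a b hab
  obtain rfl : z₁ = z := Subtype.ext (hz₁.trans hz.symm)
  obtain rfl : z₂ = z₁ := Subtype.ext (hz₂.trans hz.symm)
  -- Adding the null set `{b}` lets continuity on `]a, b]` carry the a.e. equality to `b` itself.
  have hff : f =ᵐ[volume.restrict (Ioc a b)] f' := by
    rw [← Measure.restrict_congr_set Ioo_ae_eq_Ioc]
    filter_upwards [hf, hf', (ae_restrict_iff' measurableSet_Ioo).2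
      (hy.mono fun s hs (hsab : s ∈ Ioo a b) => hs (hab.2.1 hsab))] with s h1 h2 h3
    rw [h1, h2, h3]
  rw [hgz, hgz']
  exact (Measure.eqOn_Ioc_of_ae_eq _ hff hfc hfc' ⟨hab.1, le_rfl⟩).symm

/-- The representative `w` is kept; `A` loses the null set of lines having a right end point where
`g'` and `g` differ. -/
theorem IsDirectionalTrace.congr_ae (ho : IsOpen Ω) (hb : Bornology.IsBounded Ω) (hθ : ‖θ‖ = 1)
    {g g' : frontier Ω → ℝ} (h : IsDirectionalTrace Ω θ u g)
    (hgg : ∀ᵐ z : frontier Ω ∂(directionalMeasure Ω θ), g' z = g z) :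
    IsDirectionalTrace Ω θ u g' := by
  obtain ⟨w, hw, A, hAs, hA, hg⟩ := h
  have hN := ae_of_ae_directionalMeasure ho hb hθ hgg
  refine ⟨w, hw, A ∩ {y | ∀ a b, (a, b) ∈ intervals (slice Ω θ y) →
      ∀ z : frontier Ω, (z : E d) = b • θ + (y : E d) → g' z = g z},
    inter_subset_left.trans hAs, ?_, ?_⟩
  · refine measure_mono_null ?_ (measure_union_null hA (ae_iff.1 hN))
    rintro y ⟨hy, hy'⟩
    by_cases hyA : y ∈ A
    · exact Or.inr fun h => hy' ⟨hyA, h⟩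
    · exact Or.inl ⟨hy, hyA⟩
  · rintro y ⟨hyA, hy⟩
    refine ⟨(hg y hyA).1, fun a b hab => ?_⟩
    obtain ⟨f, hfc, hf, z, hz, hgz⟩ := (hg y hyA).2 a b hab
    exact ⟨f, hfc, hf, z, hz, (hy a b hab z hz).trans hgz⟩

/-- The limit of the averages of `U` over the segments `[z - h θ, z]`, as `h → 0` along the
sequence `1 / (n + 1)`. -/
def averageLimit (θ : E d) (U : E d → ℝ) (z : E d) : ℝ :=
  limUnder atTop fun n : ℕ => ((n : ℝ) + 1) * ∫ t in Ioo 0 ((n : ℝ) + 1)⁻¹, U (z - t • θ)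

theorem measurable_averageLimit {U : E d → ℝ} (hU : StronglyMeasurable U) :
    Measurable (averageLimit θ U) := by
  refine (StronglyMeasurable.limUnder fun n => ?_).measurable
  refine StronglyMeasurable.const_mul ?_ _
  have hm : Measurable fun p : E d × ℝ => p.1 - p.2 • θ := by fun_prop
  exact StronglyMeasurable.integral_prod_right (f := fun z (t : ℝ) => U (z - t • θ))
    (hU.comp_measurable hm)

theorem exists_measurable_isDirectionalTrace (ho : IsOpen Ω) (hb : Bornology.IsBounded Ω)
    (hθ : ‖θ‖ = 1) (hu : u ∈ W Ω θ) :
    ∃ g : frontier Ω → ℝ, Measurable g ∧ IsDirectionalTrace Ω θ u g := by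
  obtain ⟨v, hv⟩ := hu
  have hfin : IsFiniteMeasure (volume.restrict Ω) :=
    ⟨by simpa using hb.measure_lt_top⟩
  have hΩ := ho.measurableSet
  have hm : ∀ f : Lp ℝ 2 (volume.restrict Ω), StronglyMeasurable (Ω.indicator f) := fun f =>
    (Lp.stronglyMeasurable f).indicator hΩ
  have h2 : ∀ f : Lp ℝ 2 (volume.restrict Ω), MemLp (Ω.indicator f) 2 := fun f =>
    (memLp_indicator_iff_restrict hΩ).2 (Lp.memLp f)
  have h1 : ∀ f : Lp ℝ 2 (volume.restrict Ω), Integrable (Ω.indicator f) := fun f =>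
    (integrable_indicator_iff hΩ).2 ((Lp.memLp f).integrable one_le_two)
  have hmul : ∀ (f : Lp ℝ 2 (volume.restrict Ω)) (χ : E d → ℝ),
      ∫ x, Ω.indicator f x * χ x = ∫ x in Ω, f x * χ x := fun f χ => by
    rw [← integral_indicator hΩ]
    congr 1 with x
    rw [indicator_mul_left]
  have hH1 := ae_memH1_slice ho hθ (h1 u) (h1 v) (hm u) (hm v) (h2 u) (h2 v) fun φ hφ => by
    rw [hmul, hmul]
    exact hv φ hφ
  -- The formula is used at every `z`; where the averages diverge, `limUnder` takes a default value,
  -- which affects neither measurability nor the end points of the lines in `A`.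
  refine ⟨fun z => averageLimit θ (Ω.indicator u) z,
    (measurable_averageLimit (hm u)).comp measurable_subtype_coe, Ω.indicator u,
    indicator_ae_eq_restrict hΩ, shadow Ω θ ∩ {y | MemH1 (slice Ω θ y)
      fun s => Ω.indicator u (s • θ + (y : E d))}, inter_subset_left, ?_, ?_⟩
  · refine measure_mono_null ?_ (ae_iff.1 hH1)
    rintro y ⟨hy, hy'⟩ h
    exact hy' ⟨hy, h⟩
  · rintro y ⟨-, hy⟩
    refine ⟨hy, fun a b hab => ?_⟩
    obtain ⟨F, hF, hFu⟩ := hy.exists_continuous hab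
    refine ⟨F, hF.continuousOn, hFu, ⟨_, endpoint_mem_frontier ho hb hθ hab⟩, rfl, ?_⟩
    refine Tendsto.limUnder_eq ?_
    have e : ∀ t : ℝ, b • θ + (y : E d) - t • θ = (b - t) • θ + (y : E d) := fun t => by module
    simp only [e]
    exact tendsto_average_left hab.1 hF hFu

end DirTrace

end

theorem mainTheorem5 {d : ℕ} (Ω : Set (DirTrace.E d)) (hΩ : IsOpen Ω)
    (hb : Bornology.IsBounded Ω) (θ : DirTrace.E d) (hθ : ‖θ‖ = 1)
    (u : Lp ℝ 2 (volume.restrict Ω)) (hu : u ∈ DirTrace.W Ω θ) :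
    (∀ g : frontier Ω → ℝ, DirTrace.IsDirectionalTrace Ω θ u g →
      ∀ g' : frontier Ω → ℝ, DirTrace.IsDirectionalTrace Ω θ u g' ↔
        ∀ᵐ z ∂(DirTrace.directionalMeasure Ω θ), g' z = g z) ∧
    ∃ g₀ : frontier Ω → ℝ, Measurable g₀ ∧
      DirTrace.directionalTrace Ω θ u =
        {g : frontier Ω → ℝ | ∀ᵐ z ∂(DirTrace.directionalMeasure Ω θ), g z = g₀ z} := by
  have key : ∀ g : frontier Ω → ℝ, DirTrace.IsDirectionalTrace Ω θ u g →
      ∀ g' : frontier Ω → ℝ, DirTrace.IsDirectionalTrace Ω θ u g' ↔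
        ∀ᵐ z ∂(DirTrace.directionalMeasure Ω θ), g' z = g z := fun g hg g' =>
    ⟨fun hg' => hg.ae_eq hΩ hb hθ hg', fun h => hg.congr_ae hΩ hb hθ h⟩
  obtain ⟨g₀, hm, hg₀⟩ := DirTrace.exists_measurable_isDirectionalTrace hΩ hb hθ hu
  exact ⟨key, g₀, hm, Set.ext fun g => key g₀ hg₀ g⟩
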